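/- Let $n\ge 0$ be an integer, let $$A_n(z)=\sum_{k=0}^n\binom nk\,(n+k)!\,z^{n-k},$$ and let $f_n(t)=t^n e^{-t}\mathbf 1_{(0,\infty)}(t)$ for $t\in\mathbb R$. For $f:\mathbb R\to\mathbb C$ the ambiguity function is $$A(f,f)(x,\xi)=\int_{\mathbb R} f\left(t+\tfrac x2\right)\overline{f\left(t-\tfrac x2\right)}\,e^{-2\pi i\xi t}\,dt .$$ Then: (1) $A_n$ is a Hurwitz polynomial, i.e. every root $z\in\mathbb C$ of $A_n$ satisfies $\operatorname{Re} z<0$. (2) For all $x,\xi\in\mathbb R$ the integral defining $A(f_n,f_n)(x,\xi)$ converges absolutely, and $$A(f_n,f_n)(x,\xi)=e^{-|x|(1+i\pi\xi)}\,\frac{1}{(2+2\pi i\xi)^{2n+1}}\,A_n\bigl(|x|(2+2\pi i\xi)\bigr).$$ (3) The ambiguity function of $f_n$ has no zeros: $A(f_n,f_n)(x,\xi)\ne 0$ for all $x,\xi\in\mathbb R$. -/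

import Mathlib

/-- The integrand of the (cross-)ambiguity function of `f` and `g` at the point `(x, ξ)`. -/
noncomputable def ambiguityIntegrand (f g : ℝ → ℂ) (x ξ : ℝ) (t : ℝ) : ℂ :=
  f (t + x / 2) * (starRingEnd ℂ) (g (t - x / 2)) *
    Complex.exp (-(2 * Complex.I * (Real.pi : ℂ) * (ξ : ℂ) * (t : ℂ)))

/-- The (cross-)ambiguity function
`A(f,g)(x,ξ) = ∫ f(t + x/2) * conj (g(t - x/2)) * exp(-2iπξt) dt` over the real line. -/
noncomputable def ambiguity (f g : ℝ → ℂ) (x ξ : ℝ) : ℂ :=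
  ∫ t : ℝ, ambiguityIntegrand f g x ξ t

/-- The function `f_n(t) = t ^ n * exp(-t)` for `t > 0`, and `0` for `t ≤ 0`. -/
noncomputable def gammaFun (n : ℕ) : ℝ → ℂ :=
  Set.indicator (Set.Ioi (0 : ℝ)) (fun t : ℝ => (t : ℂ) ^ n * Complex.exp (-(t : ℂ)))

/-- The polynomial `A_n(z) = ∑_{k=0}^n (n choose k) (n+k)! z^(n-k)`. -/
noncomputable def polyA (n : ℕ) : Polynomial ℂ :=
  ∑ k ∈ Finset.range (n + 1),
    Polynomial.C (((n.choose k : ℕ) : ℂ) * ((Nat.factorial (n + k) : ℕ) : ℂ)) *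
      Polynomial.X ^ (n - k)

/-- A Hurwitz (stable) polynomial: all its complex roots have negative real part.
The zero polynomial is not Hurwitz, since every complex number is a root of it. -/
def IsHurwitz (p : Polynomial ℂ) : Prop :=
  ∀ z : ℂ, p.IsRoot z → z.re < 0

/-! Stability comes from a continued fraction. Dividing the recurrence `polyA_eval_recurrence` by `z
* A_{n+1}(z)`, the quotients `q_n = A_{n+1}(z) / (z * A_n(z))` satisfy `q_{n+1} = α / z + β / q_n`
with `α, β > 0`. Inversion preserves the right half-plane, so for `Re z ≥ 0`, `z ≠ 0`, every `q_n`
has positive real part and no `A_n(z)` vanishes.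

The ambiguity function reduces to the Laplace transform of `(s + |x|)^n * s^n` at `w = 2 + 2πiξ`.
Binomial expansion turns it into `A_n(|x| * w) / w^(2n+1)`. Since `Re (|x| * w) = 2|x| ≥ 0`,
stability excludes zeros. -/

theorem polyA_eval (n : ℕ) (z : ℂ) :
    (polyA n).eval z =
      ∑ k ∈ Finset.range (n + 1),
        ((n.choose k : ℂ) * ((n + k).factorial : ℂ)) * z ^ (n - k) := by
  simp [polyA, Polynomial.eval_finsetSum]

/-- Coefficient of `z^(n+1-j)` in the three-term recurrence. -/
theorem choose_mul_factorial_recurrence (n j : ℕ) (hj : j ≤ n + 1) :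
    ((n + 2).choose (j + 1) : ℂ) * ((n + 3 + j).factorial : ℂ) =
      2 * (2 * n + 3) * (n + 2) * (((n + 1).choose j : ℂ) * ((n + 1 + j).factorial : ℂ)) +
        (n + 2) * (n + 1) * ((n.choose (j + 1) : ℂ) * ((n + 1 + j).factorial : ℂ)) := by
  have hfac : ((n + 3 + j).factorial : ℂ) =
      (n + 3 + j) * (n + 2 + j) * ((n + 1 + j).factorial : ℂ) := by
    rw [show n + 3 + j = n + 1 + j + 1 + 1 by ring, Nat.factorial_succ, Nat.factorial_succ]
    push_cast
    ring
  have h1 : ((n + 2).choose (j + 1) : ℂ) * (j + 1) = (n + 2) * ((n + 1).choose j : ℂ) := by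
    have := Nat.add_one_mul_choose_eq (n + 1) j
    have := congrArg (Nat.cast (R := ℂ)) this
    push_cast at this
    linear_combination -this
  have h2 : (n.choose (j + 1) : ℂ) * (j + 1) = (n.choose j : ℂ) * (n - j) := by
    rcases Nat.lt_or_ge n j with h | h
    · simp [Nat.choose_eq_zero_of_lt h, Nat.choose_eq_zero_of_lt (h.trans (Nat.lt_succ_self j))]
    · have := congrArg (Nat.cast (R := ℂ)) (Nat.choose_succ_right_eq n j)
      push_cast [Nat.cast_sub h] at this
      exact this
  have h3 : ((n + 1).choose j : ℂ) * (n + 1 - j) = (n + 1) * (n.choose j : ℂ) := by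
    have := congrArg (Nat.cast (R := ℂ)) (Nat.choose_mul_succ_eq n j)
    push_cast [Nat.cast_sub hj] at this
    linear_combination -this
  -- After multiplication by `j + 1`, every binomial becomes a multiple of `(n + 1).choose j`; what
  -- remains is `(n+3+j)(n+2+j) = 2(2n+3)(j+1) + (n+1-j)(n-j)`.
  have hj0 : (j + 1 : ℂ) ≠ 0 := Nat.cast_add_one_ne_zero j
  apply mul_right_cancel₀ hj0
  rw [hfac]
  linear_combination ((n + 1 + j).factorial : ℂ) *
    ((n + 3 + j) * (n + 2 + j) * h1 - (n + 2) * (n + 1) * h2 + (n + 2) * (n - j) * h3)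

/-- Three-term recurrence for the polynomials `polyA n`, which are rescaled reverse Bessel
polynomials. -/
theorem polyA_eval_recurrence (n : ℕ) (z : ℂ) :
    (polyA (n + 2)).eval z =
      2 * (2 * n + 3) * (n + 2) * (polyA (n + 1)).eval z +
        (n + 2) * (n + 1) * z ^ 2 * (polyA n).eval z := by
  have hA : z ^ 2 * (polyA n).eval z = (n.factorial : ℂ) * z ^ (n + 2) +
      ∑ j ∈ Finset.range (n + 2),
        ((n.choose (j + 1) : ℂ) * ((n + 1 + j).factorial : ℂ)) * z ^ (n + 1 - j) := by
    rw [polyA_eval, Finset.sum_range_succ', Finset.sum_range_succ, Finset.sum_range_succ, mul_add,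
      Finset.mul_sum]
    have : ∀ j ∈ Finset.range n,
        z ^ 2 * (((n.choose (j + 1) : ℂ) * ((n + (j + 1)).factorial : ℂ)) * z ^ (n - (j + 1))) =
        ((n.choose (j + 1) : ℂ) * ((n + 1 + j).factorial : ℂ)) * z ^ (n + 1 - j) := by
      intro j hj
      rw [Finset.mem_range] at hj
      rw [show n + 1 - j = n - (j + 1) + 2 by omega, show n + (j + 1) = n + 1 + j by ring]
      ring
    rw [Finset.sum_congr rfl this]
    -- The terms `j = n` and `j = n + 1` are zero; they only pad the sum to the range used for
    -- `A_{n+1}`.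
    simp only [Nat.choose_succ_self, Nat.choose_eq_zero_of_lt (show n < n + 1 + 1 by omega),
      Nat.choose_zero_right, Nat.cast_zero, Nat.cast_one, zero_mul, add_zero, Nat.sub_zero]
    ring
  have hsum : ∑ j ∈ Finset.range (n + 2),
        ((n + 2).choose (j + 1) : ℂ) * ((n + 2 + (j + 1)).factorial : ℂ) *
          z ^ (n + 2 - (j + 1)) =
      2 * (2 * n + 3) * (n + 2) * (polyA (n + 1)).eval z +
        (n + 2) * (n + 1) * ∑ j ∈ Finset.range (n + 2),
          ((n.choose (j + 1) : ℂ) * ((n + 1 + j).factorial : ℂ)) * z ^ (n + 1 - j) := by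
    rw [polyA_eval, Finset.mul_sum, Finset.mul_sum, ← Finset.sum_add_distrib]
    refine Finset.sum_congr rfl fun j hj => ?_
    rw [Finset.mem_range] at hj
    have := choose_mul_factorial_recurrence n j (by omega)
    rw [show n + 2 + (j + 1) = n + 3 + j by ring, show n + 2 - (j + 1) = n + 1 - j by omega, this]
    ring
  rw [mul_assoc ((n + 2 : ℂ) * (n + 1)), hA, polyA_eval (n + 2), Finset.sum_range_succ', hsum]
  simp only [Nat.choose_zero_right, add_zero, Nat.sub_zero, Nat.factorial_succ]
  push_cast
  ring

/-- The quotients divide by `z`, so the origin is separate: the constant term is `(2n)!`. -/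
theorem polyA_eval_zero_ne_zero (n : ℕ) : (polyA n).eval 0 ≠ 0 := by
  rw [polyA_eval, Finset.sum_range_succ, Finset.sum_eq_zero]
  · simp [Nat.factorial_ne_zero]
  · intro k hk
    rw [Finset.mem_range] at hk
    simp [Nat.sub_ne_zero_of_lt hk]

theorem Complex.inv_re_pos {q : ℂ} (hq : 0 < q.re) : 0 < q⁻¹.re := by
  have : q ≠ 0 := fun h => by simp [h] at hq
  rw [Complex.inv_re]
  exact div_pos hq (Complex.normSq_pos.2 this)

/-- For `z ≠ 0` in the closed right half-plane, the consecutive quotients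
`A_{n+1}(z) / (z A_n(z))` stay in the open right half-plane. -/
theorem polyA_eval_ne_zero_and_quotient_re_pos {z : ℂ} (hz : 0 ≤ z.re) (hz0 : z ≠ 0) (n : ℕ) :
    (polyA n).eval z ≠ 0 ∧ 0 < ((polyA (n + 1)).eval z / (z * (polyA n).eval z)).re := by
  have hinv : 0 ≤ (z⁻¹).re := by
    rw [Complex.inv_re]
    exact div_nonneg hz (Complex.normSq_nonneg z)
  induction n with
  | zero =>
    have h0 : (polyA 0).eval z = 1 := by simp [polyA_eval]
    have h1 : (polyA 1).eval z = z + 2 := by simp [polyA_eval, Finset.sum_range_succ]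
    refine ⟨by simp [h0], ?_⟩
    -- The initial quotient is `1 + 2 / z`.
    rw [zero_add, h0, h1, mul_one, add_div, div_self hz0, div_eq_mul_inv]
    rw [Complex.add_re, Complex.one_re, show (2 : ℂ) = ((2 : ℝ) : ℂ) by simp, Complex.re_ofReal_mul]
    positivity
  | succ n ih =>
    obtain ⟨hn, hq⟩ := ih
    have hne : (polyA (n + 1)).eval z ≠ 0 := fun h => by simp [h] at hq
    refine ⟨hne, ?_⟩
    have key : (polyA (n + 1 + 1)).eval z / (z * (polyA (n + 1)).eval z) =
        ((2 * (2 * n + 3) * (n + 2) : ℝ) : ℂ) * z⁻¹ + (((n + 2) * (n + 1) : ℝ) : ℂ) *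
          ((polyA (n + 1)).eval z / (z * (polyA n).eval z))⁻¹ := by
      rw [polyA_eval_recurrence]
      push_cast
      field_simp
    rw [key, Complex.add_re, Complex.re_ofReal_mul, Complex.re_ofReal_mul]
    have := Complex.inv_re_pos hq
    positivity

theorem polyA_eval_ne_zero {z : ℂ} (hz : 0 ≤ z.re) (n : ℕ) : (polyA n).eval z ≠ 0 := by
  rcases eq_or_ne z 0 with rfl | hz0
  · exact polyA_eval_zero_ne_zero n
  · exact (polyA_eval_ne_zero_and_quotient_re_pos hz hz0 n).1

theorem isHurwitz_polyA (n : ℕ) : IsHurwitz (polyA n) := fun _ hz =>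
  not_le.1 fun h => polyA_eval_ne_zero h n hz

theorem integrableOn_pow_mul_cexp_neg_mul {w : ℂ} (hw : 0 < w.re) (m : ℕ) :
    MeasureTheory.IntegrableOn (fun t : ℝ => (t : ℂ) ^ m * Complex.exp (-(w * t)))
      (Set.Ioi 0) := by
  have hm : (-1 : ℝ) < m := lt_of_lt_of_le (by norm_num) m.cast_nonneg
  refine MeasureTheory.Integrable.mono'
    (integrableOn_rpow_mul_exp_neg_mul_rpow hm one_pos hw) ?_ ?_
  · exact Continuous.aestronglyMeasurable (by fun_prop)
  · filter_upwards [MeasureTheory.ae_restrict_mem measurableSet_Ioi] with t ht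
    have ht : 0 < t := ht
    simp [Complex.norm_exp, abs_of_pos ht]

theorem tendsto_pow_mul_cexp_neg_mul_atTop {w : ℂ} (hw : 0 < w.re) (m : ℕ) :
    Filter.Tendsto (fun t : ℝ => (t : ℂ) ^ m * Complex.exp (-(w * t))) Filter.atTop (nhds 0) := by
  rw [tendsto_zero_iff_norm_tendsto_zero]
  refine (tendsto_rpow_mul_exp_neg_mul_atTop_nhds_zero m w.re hw).congr' ?_
  filter_upwards [Filter.eventually_gt_atTop 0] with t ht
  simp [Complex.norm_exp, abs_of_pos ht]

theorem integral_pow_mul_cexp_neg_mul_Ioi {w : ℂ} (hw : 0 < w.re) (m : ℕ) :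
    ∫ t : ℝ in Set.Ioi 0, (t : ℂ) ^ m * Complex.exp (-(w * t)) =
      (m.factorial : ℂ) / w ^ (m + 1) := by
  have hw0 : w ≠ 0 := fun h => by simp [h] at hw
  induction m with
  | zero =>
    have := integral_exp_mul_complex_Ioi (a := -w) (by simpa) 0
    simpa using this
  | succ m ih =>
    have hderiv : ∀ t ∈ Set.Ici (0 : ℝ),
        HasDerivAt (fun t : ℝ => (t : ℂ) ^ (m + 1) * Complex.exp (-(w * t)))
          ((m + 1) * ((t : ℂ) ^ m * Complex.exp (-(w * t))) -
            w * ((t : ℂ) ^ (m + 1) * Complex.exp (-(w * t)))) t := by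
      intro t _
      have h1 : HasDerivAt (fun z : ℂ => z ^ (m + 1) * Complex.exp (-(w * z)))
          (((m + 1 : ℕ) : ℂ) * (t : ℂ) ^ m * Complex.exp (-(w * t)) +
            (t : ℂ) ^ (m + 1) * (Complex.exp (-(w * t)) * -(w * 1))) t :=
        (hasDerivAt_pow (m + 1) (t : ℂ)).mul ((hasDerivAt_id _).const_mul w).neg.cexp
      convert h1.comp_ofReal using 1
      push_cast
      ring
    have i0 := (integrableOn_pow_mul_cexp_neg_mul hw m).const_mul (m + 1 : ℂ)
    have i1 := (integrableOn_pow_mul_cexp_neg_mul hw (m + 1)).const_mul w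
    -- Both boundary values of `t^(m+1) * exp(-w t)` vanish, so `w * I_{m+1} = (m+1) * I_m`.
    have := MeasureTheory.integral_Ioi_of_hasDerivAt_of_tendsto' hderiv (i0.sub i1)
      (tendsto_pow_mul_cexp_neg_mul_atTop hw (m + 1))
    rw [MeasureTheory.integral_sub i0 i1, MeasureTheory.integral_const_mul,
      MeasureTheory.integral_const_mul, ih] at this
    simp only [Complex.ofReal_zero, ne_eq, Nat.add_eq_zero_iff, one_ne_zero, and_false,
      not_false_eq_true, zero_pow, zero_mul, sub_zero, sub_eq_zero] at this
    rw [eq_div_iff (pow_ne_zero _ hw0), Nat.factorial_succ]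
    field_simp at this
    push_cast
    linear_combination -this

/-- After the substitution `t = s + |x| / 2`, the integrand of the ambiguity function of
`gammaFun n` is supported on `s > 0`, where it depends on `x` only through `|x|`. -/
theorem ambiguityIntegrand_gammaFun (n : ℕ) (x ξ t : ℝ) :
    ambiguityIntegrand (gammaFun n) (gammaFun n) x ξ t =
      (Set.Ioi (0 : ℝ)).indicator (fun s : ℝ =>
        Complex.exp (-((|x| : ℝ) : ℂ) * (1 + Complex.I * (Real.pi : ℂ) * (ξ : ℂ))) *
          ((s + |x|) ^ n * s ^ n *
            Complex.exp (-((2 + 2 * (Real.pi : ℂ) * Complex.I * (ξ : ℂ)) * s)))) (t - |x| / 2) := by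
  unfold ambiguityIntegrand gammaFun
  by_cases h : 0 < t - |x| / 2
  · have h1 : 0 < t + x / 2 := by linarith [neg_abs_le x]
    have h2 : 0 < t - x / 2 := by linarith [le_abs_self x]
    rw [Set.indicator_of_mem (Set.mem_Ioi.2 h), Set.indicator_of_mem (Set.mem_Ioi.2 h1),
      Set.indicator_of_mem (Set.mem_Ioi.2 h2), map_mul, map_pow, ← Complex.exp_conj, map_neg,
      Complex.conj_ofReal, mul_mul_mul_comm, ← mul_pow, ← mul_pow, ← Complex.exp_add, mul_assoc,
      ← Complex.exp_add, mul_left_comm, ← Complex.exp_add]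
    -- With `s = t - |x|/2`, both `(t + x/2)(t - x/2)` and `(s + |x|) * s` equal `t^2 - x^2/4`.
    have hx : ((|x| : ℝ) : ℂ) ^ 2 = (x : ℂ) ^ 2 := by exact_mod_cast sq_abs x
    congr 2
    · push_cast
      linear_combination hx / 4
    · push_cast
      ring
  · rw [Set.indicator_of_notMem (s := Set.Ioi (0 : ℝ)) (a := t - |x| / 2) h]
    rcases le_total 0 x with hx | hx
    · rw [abs_of_nonneg hx] at h
      rw [Set.indicator_of_notMem (s := Set.Ioi (0 : ℝ)) (a := t - x / 2) h, map_zero, mul_zero,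
        zero_mul]
    · rw [abs_of_nonpos hx, neg_div, sub_neg_eq_add] at h
      rw [Set.indicator_of_notMem (s := Set.Ioi (0 : ℝ)) (a := t + x / 2) h, zero_mul, zero_mul]

theorem add_pow_mul_pow_mul_eq_sum (n : ℕ) (a s c : ℂ) :
    (s + a) ^ n * s ^ n * c =
      ∑ k ∈ Finset.range (n + 1), (n.choose k : ℂ) * a ^ (n - k) * (s ^ (n + k) * c) := by
  rw [add_pow, Finset.sum_mul, Finset.sum_mul]
  refine Finset.sum_congr rfl fun k _ => ?_
  ring

theorem integrableOn_add_pow_mul_pow_mul_cexp {w : ℂ} (hw : 0 < w.re) (a : ℂ) (n : ℕ) :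
    MeasureTheory.IntegrableOn
      (fun s : ℝ => ((s : ℂ) + a) ^ n * (s : ℂ) ^ n * Complex.exp (-(w * s))) (Set.Ioi 0) := by
  simp only [add_pow_mul_pow_mul_eq_sum]
  exact MeasureTheory.integrable_finsetSum _ fun k _ =>
    (integrableOn_pow_mul_cexp_neg_mul hw (n + k)).const_mul _

theorem integral_add_pow_mul_pow_mul_cexp {w : ℂ} (hw : 0 < w.re) (a : ℂ) (n : ℕ) :
    ∫ s : ℝ in Set.Ioi 0, ((s : ℂ) + a) ^ n * (s : ℂ) ^ n * Complex.exp (-(w * s)) =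
      1 / w ^ (2 * n + 1) * (polyA n).eval (a * w) := by
  have hw0 : w ≠ 0 := fun h => by simp [h] at hw
  simp only [add_pow_mul_pow_mul_eq_sum]
  rw [MeasureTheory.integral_finsetSum _ fun k _ =>
    (integrableOn_pow_mul_cexp_neg_mul hw (n + k)).const_mul _, polyA_eval, Finset.mul_sum]
  refine Finset.sum_congr rfl fun k hk => ?_
  rw [MeasureTheory.integral_const_mul, integral_pow_mul_cexp_neg_mul_Ioi hw]
  have hk : k ≤ n := Nat.lt_succ_iff.1 (Finset.mem_range.1 hk)
  -- The factor `w^(n-k)` cancels the one in `(a * w)^(n-k)`, leaving the `w^(n+k+1)` of the Gamma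
  -- integral.
  rw [show 2 * n + 1 = (n + k + 1) + (n - k) by omega, mul_pow, pow_add w (n + k + 1)]
  field_simp

theorem mainTheorem2 (n : ℕ) :
    IsHurwitz (polyA n) ∧
      ∀ x ξ : ℝ,
        MeasureTheory.Integrable (ambiguityIntegrand (gammaFun n) (gammaFun n) x ξ) ∧
        ambiguity (gammaFun n) (gammaFun n) x ξ =
          Complex.exp (-((|x| : ℝ) : ℂ) * (1 + Complex.I * (Real.pi : ℂ) * (ξ : ℂ))) *
            (1 / (2 + 2 * (Real.pi : ℂ) * Complex.I * (ξ : ℂ)) ^ (2 * n + 1)) *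
            (polyA n).eval
              (((|x| : ℝ) : ℂ) * (2 + 2 * (Real.pi : ℂ) * Complex.I * (ξ : ℂ))) ∧
        ambiguity (gammaFun n) (gammaFun n) x ξ ≠ 0 := by
  refine ⟨isHurwitz_polyA n, fun x ξ => ?_⟩
  have hw : 0 < (2 + 2 * (Real.pi : ℂ) * Complex.I * (ξ : ℂ)).re := by simp
  have hw0 : 2 + 2 * (Real.pi : ℂ) * Complex.I * (ξ : ℂ) ≠ 0 := fun h => by simp [h] at hw
  have hfun := funext (ambiguityIntegrand_gammaFun n x ξ)
  have hformula : ambiguity (gammaFun n) (gammaFun n) x ξ =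
      Complex.exp (-((|x| : ℝ) : ℂ) * (1 + Complex.I * (Real.pi : ℂ) * (ξ : ℂ))) *
        (1 / (2 + 2 * (Real.pi : ℂ) * Complex.I * (ξ : ℂ)) ^ (2 * n + 1)) *
        (polyA n).eval
          (((|x| : ℝ) : ℂ) * (2 + 2 * (Real.pi : ℂ) * Complex.I * (ξ : ℂ))) := by
    unfold ambiguity
    rw [hfun, MeasureTheory.integral_sub_right_eq_self,
      MeasureTheory.integral_indicator measurableSet_Ioi, MeasureTheory.integral_const_mul,
      integral_add_pow_mul_pow_mul_cexp hw, ← mul_assoc]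
  refine ⟨?_, hformula, ?_⟩
  · rw [hfun]
    exact ((MeasureTheory.integrable_indicator_iff measurableSet_Ioi).2
      ((integrableOn_add_pow_mul_pow_mul_cexp hw _ n).const_mul _)).comp_sub_right _
  · rw [hformula]
    refine mul_ne_zero (mul_ne_zero (Complex.exp_ne_zero _)
      (one_div_ne_zero (pow_ne_zero _ hw0))) (polyA_eval_ne_zero ?_ n)
    rw [Complex.re_ofReal_mul]
    exact mul_nonneg (abs_nonneg x) hw.le
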